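/- Let $\mathbb F=\mathbb F_q$ be a finite field. A $q$-matroid is a pair $(E,\rho)$, where $E$ is a finite-dimensional $\mathbb F$-vector space with subspace lattice $\mathcal L(E)$ and $\rho:\mathcal L(E)\to\mathbb N_0$ satisfies, for all $V,W\in\mathcal L(E)$: $\rho(V)\le\dim V$; $\rho(V)\le\rho(W)$ if $V\le W$; and $\rho(V+W)+\rho(V\cap W)\le\rho(V)+\rho(W)$. A subspace $V$ is a flat if it equals its closure $\overline V=\sum\{X : \dim X=1,\ \rho(V+X)=\rho(V)\}$. An $\mathcal L$-map $\phi:E_1\to E_2$ is a (possibly nonlinear) map such that $\phi(V)$ is a subspace of $E_2$ for every $V\in\mathcal L(E_1)$; its $\mathcal L$-class $[\phi]$ is the set of all $\mathcal L$-maps $\psi:E_1\to E_2$ with $\psi(V)=\phi(V)$ for all $V\in\mathcal L(E_1)$. An $\mathcal L$-map from $(E_1,\rho_1)$ to $(E_2,\rho_2)$ is strong if the preimage of every flat is a flat (in particular a subspace), weak if $\rho_2(\phi(V))\le\rho_1(V)$ for all $V\in\mathcal L(E_1)$, and rank-preserving if $\rho_2(\phi(V))=\rho_1(V)$ for all $V\in\mathcal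 L(E_1)$. An $\mathcal L$-class is strong, weak or rank-preserving if its members are (this does not depend on the member), and linear if it contains a linear map. For $\Delta\in\{\mathsf{s},\mathsf{rp},\mathsf{w},\mathsf{l\text{-}s},\mathsf{l\text{-}rp},\mathsf{l\text{-}w}\}$ let $q\text{-}\mathbf{Mat}^{[\Delta]}$ be the category whose objects are the $q$-matroids over $\mathbb F_q$ and whose morphisms are, respectively, the strong, rank-preserving, weak, linear strong, linear rank-preserving and linear weak $\mathcal L$-classes, with composition $[\psi]\circ[\phi]=[\psi\circ\phi]$. Theorem. (1) Any two objects of $q\text{-}\mathbf{Mat}^{[\Delta]}$ have a coproduct if and only if $q=2$ and $\Delta=\mathsf{l\text{-}w}$; that is, in each of the remaining cases there are two $q$-matroids that have no coproduct in $q\text{-}\mathbf{Mat}^{[\Delta]}$. (2) If $q=2$, then for any two $q$-matroids $M_1=(E_1,\rho_1)$ and $M_2=(E_2,\rho_2)$ the triple $(M_1\oplus M_2,[\iota_1],[\iota_2])$ is a coproduct of $M_1$ and $M_2$ in $q\text{-}\mathbf{Mat}^{[\mathsf{l\text{-}w}]}$. Here $M_1\oplus M_2$ is the $q$-matroid on $E_1\oplus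 E_2$ with rank function $$\rho(V)=\min\{\rho_1(\pi_1(X))+\rho_2(\pi_2(X))+\dim V-\dim X : X\le V\},$$ where $\pi_i:E_1\oplus E_2\to E_i$ are the projections, and $\iota_i:E_i\to E_1\oplus E_2$ are the natural embeddings. -/

import Mathlib

open CategoryTheory CategoryTheory.Limits

universe u

/-- A `q`-matroid on the `F`-vector space `E`, given by its rank function on subspaces. -/
@[ext]
structure QMatroid (F : Type u) [Field F] (E : Type u) [AddCommGroup E] [Module F E] where
  rank : Submodule F E → ℕ
  rank_le_finrank : ∀ V, rank V ≤ Module.finrank F V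
  rank_mono : ∀ V W, V ≤ W → rank V ≤ rank W
  rank_submodular : ∀ V W, rank (V ⊔ W) + rank (V ⊓ W) ≤ rank V + rank W

namespace QMatroid

variable {F : Type u} [Field F] {E : Type u} [AddCommGroup E] [Module F E]

/-- The closure of `V`: the sum of all 1-spaces `X` with `ρ(V + X) = ρ(V)`. -/
def closure (M : QMatroid F E) (V : Submodule F E) : Submodule F E :=
  sSup {X : Submodule F E | Module.finrank F X = 1 ∧ M.rank (V ⊔ X) = M.rank V}

/-- `V` is a flat if it equals its closure. -/
def IsFlat (M : QMatroid F E) (V : Submodule F E) : Prop := M.closure V = V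

end QMatroid

/-- An `𝓛`-map: a (possibly nonlinear) map sending every subspace onto a subspace. -/
@[ext]
structure LMap (F : Type u) [Field F] (E₁ E₂ : Type u) [AddCommGroup E₁] [Module F E₁]
    [AddCommGroup E₂] [Module F E₂] where
  toFun : E₁ → E₂
  image_isSubspace : ∀ V : Submodule F E₁, ∃ W : Submodule F E₂,
    (W : Set E₂) = toFun '' (V : Set E₁)

namespace LMap

variable {F : Type u} [Field F] {E₁ E₂ E₃ : Type u} [AddCommGroup E₁] [Module F E₁]
  [AddCommGroup E₂] [Module F E₂] [AddCommGroup E₃] [Module F E₃]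

/-- The map `φ_𝓛` between subspace lattices induced by an `𝓛`-map `φ`. -/
def induced (φ : LMap F E₁ E₂) (V : Submodule F E₁) : Submodule F E₂ where
  carrier := φ.toFun '' (V : Set E₁)
  add_mem' := by
    obtain ⟨W, hW⟩ := φ.image_isSubspace V
    rw [← hW]
    exact fun ha hb => W.add_mem ha hb
  zero_mem' := by
    obtain ⟨W, hW⟩ := φ.image_isSubspace V
    rw [← hW]
    exact W.zero_mem
  smul_mem' := by
    obtain ⟨W, hW⟩ := φ.image_isSubspace V
    rw [← hW]
    exact fun c _ hx => W.smul_mem c hx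

theorem coe_induced (φ : LMap F E₁ E₂) (V : Submodule F E₁) :
    (φ.induced V : Set E₂) = φ.toFun '' (V : Set E₁) := rfl

/-- The identity `𝓛`-map. -/
def id (F : Type u) [Field F] (E : Type u) [AddCommGroup E] [Module F E] : LMap F E E where
  toFun := fun x => x
  image_isSubspace := fun V => ⟨V, by simp⟩

/-- `ψ.comp φ` is the composite `ψ ∘ φ`. -/
def comp (ψ : LMap F E₂ E₃) (φ : LMap F E₁ E₂) : LMap F E₁ E₃ where
  toFun := ψ.toFun ∘ φ.toFun
  image_isSubspace := fun V => ⟨ψ.induced (φ.induced V), by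
    rw [coe_induced, coe_induced, Set.image_comp]⟩

theorem induced_comp (ψ : LMap F E₂ E₃) (φ : LMap F E₁ E₂) (V : Submodule F E₁) :
    (ψ.comp φ).induced V = ψ.induced (φ.induced V) :=
  SetLike.coe_injective (by
    simp only [coe_induced]
    exact Set.image_comp ψ.toFun φ.toFun V)

/-- A linear map, viewed as an `𝓛`-map. -/
def ofLinear (f : E₁ →ₗ[F] E₂) : LMap F E₁ E₂ where
  toFun := f
  image_isSubspace := fun V => ⟨V.map f, Submodule.map_coe f V⟩

theorem induced_ofLinear (f : E₁ →ₗ[F] E₂) (V : Submodule F E₁) :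
    (ofLinear f).induced V = V.map f := rfl

/-- The `𝓛`-map `φ` is linear. -/
def IsLinear (φ : LMap F E₁ E₂) : Prop := IsLinearMap F φ.toFun

/-- Strong maps: preimages of flats are flats (in particular subspaces). -/
def IsStrong (M₁ : QMatroid F E₁) (M₂ : QMatroid F E₂) (φ : LMap F E₁ E₂) : Prop :=
  ∀ W : Submodule F E₂, M₂.IsFlat W →
    ∃ V : Submodule F E₁, M₁.IsFlat V ∧ (V : Set E₁) = φ.toFun ⁻¹' (W : Set E₂)

/-- Weak maps: `ρ₂(φ(V)) ≤ ρ₁(V)` for all subspaces `V`. -/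
def IsWeak (M₁ : QMatroid F E₁) (M₂ : QMatroid F E₂) (φ : LMap F E₁ E₂) : Prop :=
  ∀ V : Submodule F E₁, M₂.rank (φ.induced V) ≤ M₁.rank V

/-- Rank-preserving maps: `ρ₂(φ(V)) = ρ₁(V)` for all subspaces `V`. -/
def IsRankPreserving (M₁ : QMatroid F E₁) (M₂ : QMatroid F E₂) (φ : LMap F E₁ E₂) : Prop :=
  ∀ V : Submodule F E₁, M₂.rank (φ.induced V) = M₁.rank V

/-- `𝓛`-equivalence: `φ` and `ψ` induce the same map between the subspace lattices. -/
instance setoid (F : Type u) [Field F] (E₁ E₂ : Type u) [AddCommGroup E₁] [Module F E₁]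
    [AddCommGroup E₂] [Module F E₂] : Setoid (LMap F E₁ E₂) where
  r φ ψ := φ.induced = ψ.induced
  iseqv := ⟨fun _ => rfl, fun h => h.symm, fun h h' => h.trans h'⟩

end LMap

/-- `𝓛`-classes: equivalence classes of `𝓛`-maps under `𝓛`-equivalence. -/
def LClass (F : Type u) [Field F] (E₁ E₂ : Type u) [AddCommGroup E₁] [Module F E₁]
    [AddCommGroup E₂] [Module F E₂] : Type u :=
  Quotient (LMap.setoid F E₁ E₂)

namespace LClass

variable {F : Type u} [Field F] {E₁ E₂ E₃ : Type u} [AddCommGroup E₁] [Module F E₁]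
  [AddCommGroup E₂] [Module F E₂] [AddCommGroup E₃] [Module F E₃]

/-- The `𝓛`-class `[φ]` of an `𝓛`-map `φ`. -/
def mk (φ : LMap F E₁ E₂) : LClass F E₁ E₂ := Quotient.mk _ φ

/-- Two `𝓛`-maps have the same class exactly if they induce the same map on subspaces. -/
theorem mk_eq_mk {φ ψ : LMap F E₁ E₂} : mk φ = mk ψ ↔ φ.induced = ψ.induced :=
  ⟨fun h => Quotient.exact h, fun h => Quotient.sound h⟩

/-- Composition of classes, `[ψ] ∘ [φ] = [ψ ∘ φ]`. -/
def comp (d : LClass F E₂ E₃) (c : LClass F E₁ E₂) : LClass F E₁ E₃ :=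
  Quotient.map₂ LMap.comp (fun ψ ψ' (hψ : ψ.induced = ψ'.induced) φ φ'
    (hφ : φ.induced = φ'.induced) => by
      change (ψ.comp φ).induced = (ψ'.comp φ').induced
      funext V
      rw [LMap.induced_comp, LMap.induced_comp, hψ, hφ]) d c

theorem comp_mk (ψ : LMap F E₂ E₃) (φ : LMap F E₁ E₂) :
    comp (mk ψ) (mk φ) = mk (ψ.comp φ) := rfl

/-- A class is linear if it contains a linear map. -/
def IsLinear (c : LClass F E₁ E₂) : Prop := ∃ φ : LMap F E₁ E₂, mk φ = c ∧ φ.IsLinear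

/-- A class is strong if its members are strong (this does not depend on the representative). -/
def IsStrong (M₁ : QMatroid F E₁) (M₂ : QMatroid F E₂) (c : LClass F E₁ E₂) : Prop :=
  ∃ φ : LMap F E₁ E₂, mk φ = c ∧ φ.IsStrong M₁ M₂

/-- A class is weak if its members are weak (this does not depend on the representative). -/
def IsWeak (M₁ : QMatroid F E₁) (M₂ : QMatroid F E₂) (c : LClass F E₁ E₂) : Prop :=
  ∃ φ : LMap F E₁ E₂, mk φ = c ∧ φ.IsWeak M₁ M₂

/-- A class is rank-preserving if its members are rank-preserving (this does not depend on the
representative). -/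
def IsRankPreserving (M₁ : QMatroid F E₁) (M₂ : QMatroid F E₂) (c : LClass F E₁ E₂) : Prop :=
  ∃ φ : LMap F E₁ E₂, mk φ = c ∧ φ.IsRankPreserving M₁ M₂

end LClass

/-- The six types of morphisms. -/
inductive MapType
  | strong
  | rankPreserving
  | weak
  | linearStrong
  | linearRankPreserving
  | linearWeak

/-- The `𝓛`-class `c` from `M₁` to `M₂` is of the given type. -/
def LClass.IsOfType {F : Type u} [Field F] {E₁ E₂ : Type u} [AddCommGroup E₁] [Module F E₁]
    [AddCommGroup E₂] [Module F E₂] (Δ : MapType) (M₁ : QMatroid F E₁) (M₂ : QMatroid F E₂)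
    (c : LClass F E₁ E₂) : Prop :=
  match Δ with
  | .strong => c.IsStrong M₁ M₂
  | .rankPreserving => c.IsRankPreserving M₁ M₂
  | .weak => c.IsWeak M₁ M₂
  | .linearStrong => c.IsLinear ∧ c.IsStrong M₁ M₂
  | .linearRankPreserving => c.IsLinear ∧ c.IsRankPreserving M₁ M₂
  | .linearWeak => c.IsLinear ∧ c.IsWeak M₁ M₂

namespace LClass

variable {F : Type u} [Field F] {E₁ E₂ E₃ : Type u} [AddCommGroup E₁] [Module F E₁]
  [AddCommGroup E₂] [Module F E₂] [AddCommGroup E₃] [Module F E₃]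

theorem isLinear_id : (mk (LMap.id F E₁)).IsLinear :=
  ⟨_, rfl, ⟨fun _ _ => rfl, fun _ _ => rfl⟩⟩

theorem isStrong_id (M : QMatroid F E₁) : (mk (LMap.id F E₁)).IsStrong M M :=
  ⟨_, rfl, fun W hW => ⟨W, hW, rfl⟩⟩

theorem isRankPreserving_id (M : QMatroid F E₁) :
    (mk (LMap.id F E₁)).IsRankPreserving M M :=
  ⟨_, rfl, fun V => congrArg M.rank (SetLike.coe_injective (by simp [LMap.coe_induced, LMap.id]))⟩

theorem IsRankPreserving.isWeak {M₁ : QMatroid F E₁} {M₂ : QMatroid F E₂}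
    {c : LClass F E₁ E₂} (h : c.IsRankPreserving M₁ M₂) : c.IsWeak M₁ M₂ := by
  obtain ⟨φ, hφ, h⟩ := h
  exact ⟨φ, hφ, fun V => (h V).le⟩

theorem isOfType_id (Δ : MapType) (M : QMatroid F E₁) :
    (mk (LMap.id F E₁)).IsOfType Δ M M := by
  cases Δ with
  | strong => exact isStrong_id M
  | rankPreserving => exact isRankPreserving_id M
  | weak => exact (isRankPreserving_id M).isWeak
  | linearStrong => exact ⟨isLinear_id, isStrong_id M⟩
  | linearRankPreserving => exact ⟨isLinear_id, isRankPreserving_id M⟩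
  | linearWeak => exact ⟨isLinear_id, (isRankPreserving_id M).isWeak⟩

theorem IsLinear.comp {d : LClass F E₂ E₃} {c : LClass F E₁ E₂}
    (hd : d.IsLinear) (hc : c.IsLinear) : (d.comp c).IsLinear := by
  obtain ⟨ψ, rfl, hψ⟩ := hd
  obtain ⟨φ, rfl, hφ⟩ := hc
  refine ⟨ψ.comp φ, (comp_mk ψ φ).symm, ⟨fun x y => ?_, fun a x => ?_⟩⟩
  · change ψ.toFun (φ.toFun (x + y)) = _
    rw [hφ.map_add, hψ.map_add]; rfl
  · change ψ.toFun (φ.toFun (a • x)) = _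
    rw [hφ.map_smul, hψ.map_smul]; rfl

theorem IsStrong.comp {M₁ : QMatroid F E₁} {M₂ : QMatroid F E₂} {M₃ : QMatroid F E₃}
    {d : LClass F E₂ E₃} {c : LClass F E₁ E₂}
    (hd : d.IsStrong M₂ M₃) (hc : c.IsStrong M₁ M₂) : (d.comp c).IsStrong M₁ M₃ := by
  obtain ⟨ψ, rfl, hψ⟩ := hd
  obtain ⟨φ, rfl, hφ⟩ := hc
  refine ⟨ψ.comp φ, (comp_mk ψ φ).symm, fun W hW => ?_⟩
  obtain ⟨V, hV, hVW⟩ := hψ W hW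
  obtain ⟨U, hU, hUV⟩ := hφ V hV
  exact ⟨U, hU, by rw [hUV, hVW]; rfl⟩

theorem IsWeak.comp {M₁ : QMatroid F E₁} {M₂ : QMatroid F E₂} {M₃ : QMatroid F E₃}
    {d : LClass F E₂ E₃} {c : LClass F E₁ E₂}
    (hd : d.IsWeak M₂ M₃) (hc : c.IsWeak M₁ M₂) : (d.comp c).IsWeak M₁ M₃ := by
  obtain ⟨ψ, rfl, hψ⟩ := hd
  obtain ⟨φ, rfl, hφ⟩ := hc
  refine ⟨ψ.comp φ, (comp_mk ψ φ).symm, fun V => ?_⟩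
  rw [LMap.induced_comp]
  exact (hψ _).trans (hφ V)

theorem IsRankPreserving.comp {M₁ : QMatroid F E₁} {M₂ : QMatroid F E₂} {M₃ : QMatroid F E₃}
    {d : LClass F E₂ E₃} {c : LClass F E₁ E₂} (hd : d.IsRankPreserving M₂ M₃)
    (hc : c.IsRankPreserving M₁ M₂) : (d.comp c).IsRankPreserving M₁ M₃ := by
  obtain ⟨ψ, rfl, hψ⟩ := hd
  obtain ⟨φ, rfl, hφ⟩ := hc
  refine ⟨ψ.comp φ, (comp_mk ψ φ).symm, fun V => ?_⟩
  rw [LMap.induced_comp]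
  exact (hψ _).trans (hφ V)

theorem IsOfType.comp {Δ : MapType} {M₁ : QMatroid F E₁} {M₂ : QMatroid F E₂}
    {M₃ : QMatroid F E₃} {d : LClass F E₂ E₃} {c : LClass F E₁ E₂}
    (hd : d.IsOfType Δ M₂ M₃) (hc : c.IsOfType Δ M₁ M₂) : (d.comp c).IsOfType Δ M₁ M₃ := by
  cases Δ with
  | strong => exact IsStrong.comp hd hc
  | rankPreserving => exact IsRankPreserving.comp hd hc
  | weak => exact IsWeak.comp hd hc
  | linearStrong => exact ⟨hd.1.comp hc.1, IsStrong.comp hd.2 hc.2⟩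
  | linearRankPreserving => exact ⟨hd.1.comp hc.1, IsRankPreserving.comp hd.2 hc.2⟩
  | linearWeak => exact ⟨hd.1.comp hc.1, IsWeak.comp hd.2 hc.2⟩

end LClass

/-- The objects of the category `q-Mat^[Δ]`: `q`-matroids over `F`, i.e. finite-dimensional
`F`-vector spaces with a `q`-matroid structure. The parameter `Δ` only selects the morphisms. -/
structure QMatCat (F : Type u) [Field F] (Δ : MapType) where
  carrier : Type u
  [addCommGroup : AddCommGroup carrier]
  [module : Module F carrier]
  [finiteDimensional : FiniteDimensional F carrier]
  matroid : QMatroid F carrier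

namespace QMatCat

variable {F : Type u} [Field F] {Δ : MapType}

attribute [instance] addCommGroup module finiteDimensional

/-- Morphisms of `q-Mat^[Δ]`: the `𝓛`-classes of type `Δ`. -/
@[ext]
structure Hom (M N : QMatCat F Δ) where
  cls : LClass F M.carrier N.carrier
  isOfType : cls.IsOfType Δ M.matroid N.matroid

/-- The category `q-Mat^[Δ]`. -/
instance category : Category.{u} (QMatCat F Δ) where
  Hom M N := Hom M N
  id M := ⟨LClass.mk (LMap.id F M.carrier), LClass.isOfType_id Δ M.matroid⟩
  comp f g := ⟨g.cls.comp f.cls, g.isOfType.comp f.isOfType⟩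
  id_comp f := Hom.ext (by
    obtain ⟨c, hc⟩ := f
    induction c using Quotient.inductionOn
    rfl)
  comp_id f := Hom.ext (by
    obtain ⟨c, hc⟩ := f
    induction c using Quotient.inductionOn
    rfl)
  assoc f g h := Hom.ext (by
    obtain ⟨c, hc⟩ := f
    obtain ⟨d, hd⟩ := g
    obtain ⟨e, he⟩ := h
    induction c using Quotient.inductionOn
    induction d using Quotient.inductionOn
    induction e using Quotient.inductionOn
    rfl)

end QMatCat

namespace QMatroid

variable {F : Type u} [Field F] {E₁ E₂ : Type u} [AddCommGroup E₁] [Module F E₁]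
  [AddCommGroup E₂] [Module F E₂]

/-- The function `ρ₁' + ρ₂'` on subspaces of `E₁ ⊕ E₂`, where `ρᵢ'(X) = ρᵢ(πᵢ(X))`. -/
def projRank (M₁ : QMatroid F E₁) (M₂ : QMatroid F E₂) (X : Submodule F (E₁ × E₂)) : ℕ :=
  M₁.rank (X.map (LinearMap.fst F E₁ E₂)) + M₂.rank (X.map (LinearMap.snd F E₁ E₂))

/-- The rank function of the direct sum:
`ρ(V) = min {ρ₁'(X) + ρ₂'(X) + dim V - dim X | X ≤ V}`. -/
noncomputable def directSumRank (M₁ : QMatroid F E₁) (M₂ : QMatroid F E₂)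
    (V : Submodule F (E₁ × E₂)) : ℕ :=
  sInf {n : ℕ | ∃ X : Submodule F (E₁ × E₂), X ≤ V ∧
    n = projRank M₁ M₂ X + (Module.finrank F V - Module.finrank F X)}

theorem directSumRank_le (M₁ : QMatroid F E₁) (M₂ : QMatroid F E₂)
    {V X : Submodule F (E₁ × E₂)} (h : X ≤ V) :
    directSumRank M₁ M₂ V ≤
      projRank M₁ M₂ X + (Module.finrank F V - Module.finrank F X) :=
  Nat.sInf_le ⟨X, h, rfl⟩

theorem exists_directSumRank_eq (M₁ : QMatroid F E₁) (M₂ : QMatroid F E₂)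
    (V : Submodule F (E₁ × E₂)) : ∃ X ≤ V, directSumRank M₁ M₂ V =
      projRank M₁ M₂ X + (Module.finrank F V - Module.finrank F X) :=
  Nat.sInf_mem (s := {n : ℕ | ∃ X : Submodule F (E₁ × E₂), X ≤ V ∧
    n = projRank M₁ M₂ X + (Module.finrank F V - Module.finrank F X)}) ⟨_, V, le_rfl, rfl⟩

theorem rank_bot (M : QMatroid F E₁) : M.rank ⊥ = 0 := by
  simpa using M.rank_le_finrank ⊥

theorem projRank_mono (M₁ : QMatroid F E₁) (M₂ : QMatroid F E₂)
    {X Y : Submodule F (E₁ × E₂)} (h : X ≤ Y) : projRank M₁ M₂ X ≤ projRank M₁ M₂ Y :=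
  add_le_add (M₁.rank_mono _ _ (Submodule.map_mono h)) (M₂.rank_mono _ _ (Submodule.map_mono h))

theorem projRank_submodular (M₁ : QMatroid F E₁) (M₂ : QMatroid F E₂)
    (X Y : Submodule F (E₁ × E₂)) :
    projRank M₁ M₂ (X ⊔ Y) + projRank M₁ M₂ (X ⊓ Y) ≤
      projRank M₁ M₂ X + projRank M₁ M₂ Y := by
  have h₁ := M₁.rank_submodular (X.map (LinearMap.fst F E₁ E₂)) (Y.map (LinearMap.fst F E₁ E₂))
  have h₂ := M₂.rank_submodular (X.map (LinearMap.snd F E₁ E₂)) (Y.map (LinearMap.snd F E₁ E₂))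
  have h₃ := M₁.rank_mono _ _ (Submodule.map_inf_le (LinearMap.fst F E₁ E₂) (p := X) (q := Y))
  have h₄ := M₂.rank_mono _ _ (Submodule.map_inf_le (LinearMap.snd F E₁ E₂) (p := X) (q := Y))
  simp only [projRank, Submodule.map_sup]
  omega

variable [FiniteDimensional F E₁] [FiniteDimensional F E₂]

/-- The direct sum of two `q`-matroids, on the ground space `E₁ ⊕ E₂`. -/
noncomputable def directSum (M₁ : QMatroid F E₁) (M₂ : QMatroid F E₂) :
    QMatroid F (E₁ × E₂) where
  rank := directSumRank M₁ M₂
  rank_le_finrank V := by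
    have h := directSumRank_le M₁ M₂ (bot_le : ⊥ ≤ V)
    simpa [projRank, rank_bot] using h
  rank_mono V W hVW := by
    obtain ⟨X, hX, hr⟩ := exists_directSumRank_eq M₁ M₂ W
    have h₁ := directSumRank_le M₁ M₂ (inf_le_right : X ⊓ V ≤ V)
    have h₂ := projRank_mono M₁ M₂ (inf_le_left : X ⊓ V ≤ X)
    have h₃ := Submodule.finrank_sup_add_finrank_inf_eq X V
    have h₄ := Submodule.finrank_mono (sup_le hX hVW)
    have h₅ := Submodule.finrank_mono hX
    have h₆ := Submodule.finrank_mono (inf_le_right : X ⊓ V ≤ V)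
    omega
  rank_submodular V W := by
    obtain ⟨X, hX, hXr⟩ := exists_directSumRank_eq M₁ M₂ V
    obtain ⟨Y, hY, hYr⟩ := exists_directSumRank_eq M₁ M₂ W
    have h₁ := directSumRank_le M₁ M₂ (sup_le_sup hX hY)
    have h₂ := directSumRank_le M₁ M₂ (inf_le_inf hX hY)
    have h₃ := projRank_submodular M₁ M₂ X Y
    have h₄ := Submodule.finrank_sup_add_finrank_inf_eq X Y
    have h₅ := Submodule.finrank_sup_add_finrank_inf_eq V W
    have h₆ := Submodule.finrank_mono hX
    have h₇ := Submodule.finrank_mono hY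
    have h₈ := Submodule.finrank_mono (sup_le_sup hX hY)
    have h₉ := Submodule.finrank_mono (inf_le_inf hX hY)
    omega

theorem isWeak_inl (M₁ : QMatroid F E₁) (M₂ : QMatroid F E₂) :
    (LMap.ofLinear (LinearMap.inl F E₁ E₂)).IsWeak M₁ (directSum M₁ M₂) := fun V => by
  refine (directSumRank_le M₁ M₂ le_rfl).trans ?_
  rw [LMap.induced_ofLinear, projRank, ← Submodule.map_comp, ← Submodule.map_comp]
  simp [LinearMap.fst_comp_inl, LinearMap.snd_comp_inl, rank_bot]

theorem isWeak_inr (M₁ : QMatroid F E₁) (M₂ : QMatroid F E₂) :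
    (LMap.ofLinear (LinearMap.inr F E₁ E₂)).IsWeak M₂ (directSum M₁ M₂) := fun V => by
  refine (directSumRank_le M₁ M₂ le_rfl).trans ?_
  rw [LMap.induced_ofLinear, projRank, ← Submodule.map_comp, ← Submodule.map_comp]
  simp [LinearMap.fst_comp_inr, LinearMap.snd_comp_inr, rank_bot]

end QMatroid

namespace QMatCat

variable {F : Type u} [Field F]

/-- The direct sum `M₁ ⊕ M₂` as an object of `q-Mat^[l-w]`. -/
noncomputable def directSum (M₁ M₂ : QMatCat F .linearWeak) : QMatCat F .linearWeak where
  carrier := M₁.carrier × M₂.carrier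
  matroid := M₁.matroid.directSum M₂.matroid

/-- The class `[ι₁] : M₁ ⟶ M₁ ⊕ M₂` of the natural embedding. -/
noncomputable def inl (M₁ M₂ : QMatCat F .linearWeak) : M₁ ⟶ directSum M₁ M₂ :=
  Hom.mk (N := directSum M₁ M₂)
    (LClass.mk (LMap.ofLinear (LinearMap.inl F M₁.carrier M₂.carrier)))
    ⟨⟨_, rfl, (LinearMap.inl F M₁.carrier M₂.carrier).isLinear⟩,
      ⟨_, rfl, QMatroid.isWeak_inl M₁.matroid M₂.matroid⟩⟩

/-- The class `[ι₂] : M₂ ⟶ M₁ ⊕ M₂` of the natural embedding. -/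
noncomputable def inr (M₁ M₂ : QMatCat F .linearWeak) : M₂ ⟶ directSum M₁ M₂ :=
  Hom.mk (N := directSum M₁ M₂)
    (LClass.mk (LMap.ofLinear (LinearMap.inr F M₁.carrier M₂.carrier)))
    ⟨⟨_, rfl, (LinearMap.inr F M₁.carrier M₂.carrier).isLinear⟩,
      ⟨_, rfl, QMatroid.isWeak_inr M₁.matroid M₂.matroid⟩⟩

end QMatCat

/-! ### Flats of `q`-matroids -/

namespace QMatroid

variable {F : Type u} [Field F] {E E' : Type u} [AddCommGroup E] [Module F E]
  [AddCommGroup E'] [Module F E']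

/-! Each negative case exhibits one `q`-matroid whose coproduct with itself cannot exist. For `q ≠
2`, classes forget scalars. The map `diag(1, c)` with `c ≠ 0, 1` fixes the classes of both axis
embeddings of `F` into `F × F`, so by uniqueness it fixes the class induced on the coproduct. A
representative of that class hits `(1, 1)`, say at `p`. The image of the line of `p` is then a
`diag(1, c)`-invariant subspace containing `(1, 1)`, hence all of `F × F`, which is too large to be
the image of a line (`not_hasBinaryCoproducts_of_card_ne_two`).

For `q = 2`, a line has a single nonzero vector, so a class is the same thing as a map
(`LMap.eq_of_induced_eq`), and the types separate. If nonlinear maps are allowed, the value at the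
sum of the two generators of a coproduct is not determined by the values at the generators, and
uniqueness fails. In the linear rank-preserving case, the codiagonal bounds the rank of a coproduct
of two free lines by one, while the map to the free plane makes it two. In the linear strong case,
two rank-two targets, given by partial spreads that differ by the diagonal, impose flats on the
coproduct that contradict each other (`not_hasBinaryCoproducts_linearStrong`).

In the linear weak case the direct sum works: a linear map on `E₁ × E₂` is determined by its
restrictions, and it is weak by splitting a space into the minimizing `X` and a complement
(`isWeak_coprod`). -/

theorem isFlat_iff (M : QMatroid F E) (V : Submodule F E) :
    M.IsFlat V ↔ ∀ x, M.rank (V ⊔ F ∙ x) = M.rank V → x ∈ V := by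
  constructor
  · intro h x hx
    by_cases h0 : x = 0
    · simp [h0]
    rw [← (h : M.closure V = V)]
    exact (le_sSup (show F ∙ x ∈ {X : Submodule F E | Module.finrank F X = 1 ∧
      M.rank (V ⊔ X) = M.rank V} from ⟨finrank_span_singleton h0, hx⟩))
      (Submodule.mem_span_singleton_self x)
  · intro h
    refine le_antisymm (sSup_le ?_) fun x hx => ?_
    · rintro X ⟨hX, hr⟩
      intro x hx
      refine h x (le_antisymm ?_ (M.rank_mono _ _ le_sup_left))
      rw [← hr]
      exact M.rank_mono _ _ (sup_le_sup_left ((Submodule.span_singleton_le_iff_mem _ _).2 hx) _)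
    · by_cases h0 : x = 0
      · simp [h0]
      refine (le_sSup (show F ∙ x ∈ {X : Submodule F E | Module.finrank F X = 1 ∧
        M.rank (V ⊔ X) = M.rank V} from ⟨finrank_span_singleton h0, ?_⟩))
        (Submodule.mem_span_singleton_self x)
      rw [sup_eq_left.2 ((Submodule.span_singleton_le_iff_mem _ _).2 hx)]

theorem isFlat_top (M : QMatroid F E) : M.IsFlat ⊤ :=
  (M.isFlat_iff ⊤).2 fun _ _ => trivial

/-- Adding a subspace that does not increase the rank of `V` does not increase the rank of
a larger space. -/
theorem rank_sup_eq_of_le (M : QMatroid F E) {V Z X : Submodule F E} (h : V ≤ Z)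
    (hX : M.rank (V ⊔ X) = M.rank V) : M.rank (Z ⊔ X) = M.rank Z := by
  have h₁ := M.rank_submodular Z (V ⊔ X)
  have h₂ := M.rank_mono V (Z ⊓ (V ⊔ X)) (le_inf h le_sup_left)
  have h₃ := M.rank_mono Z (Z ⊔ X) le_sup_left
  rw [← sup_assoc, sup_eq_left.2 h] at h₁
  omega

/-- By submodularity, a vector adding no rank to `V` adds none to the larger `Z`, so it would lie in
the flat `Z`. This turns a preimage of a flat into a strict rank inequality for smaller spaces. -/
theorem IsFlat.rank_lt {M : QMatroid F E} {V Z : Submodule F E} (hZ : M.IsFlat Z) (h : V ≤ Z)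
    {x : E} (hx : x ∉ Z) : M.rank V < M.rank (V ⊔ F ∙ x) := by
  refine lt_of_le_of_ne (M.rank_mono _ _ le_sup_left) fun he => hx ?_
  exact (M.isFlat_iff Z).1 hZ x (M.rank_sup_eq_of_le h he.symm)

theorem rank_sup_span_singleton_le (M : QMatroid F E) (V : Submodule F E) (x : E) :
    M.rank (V ⊔ F ∙ x) ≤ M.rank V + 1 := by
  have h₁ := M.rank_submodular V (F ∙ x)
  have h₂ := M.rank_le_finrank (F ∙ x)
  have h₃ := finrank_span_le_card (R := F) ({x} : Set E)
  simp only [Set.toFinset_singleton, Finset.card_singleton] at h₃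
  omega

/-- A space that is maximal among those containing `V` with the same rank is a flat. -/
theorem exists_isFlat_ge [FiniteDimensional F E] (M : QMatroid F E) (V : Submodule F E) :
    ∃ Z, V ≤ Z ∧ M.IsFlat Z ∧ M.rank Z = M.rank V := by
  obtain ⟨Z, ⟨hVZ, hZ⟩, hmax⟩ := wellFounded_gt.has_min
    {Z : Submodule F E | V ≤ Z ∧ M.rank Z = M.rank V} ⟨V, le_rfl, rfl⟩
  refine ⟨Z, hVZ, (M.isFlat_iff Z).2 fun x hx => ?_, hZ⟩
  by_contra hxZ
  refine hmax (Z ⊔ F ∙ x) ⟨hVZ.trans le_sup_left, hx.trans hZ⟩ ?_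
  exact left_lt_sup.2 fun h => hxZ (h (Submodule.mem_span_singleton_self x))

/-! ### Three families of `q`-matroids -/

/-- The `q`-matroid of rank zero. -/
def trivialMatroid (F : Type u) [Field F] (E : Type u) [AddCommGroup E] [Module F E] :
    QMatroid F E where
  rank _ := 0
  rank_le_finrank _ := Nat.zero_le _
  rank_mono _ _ _ := le_rfl
  rank_submodular _ _ := le_rfl

theorem isFlat_trivialMatroid_iff {V : Submodule F E} :
    (trivialMatroid F E).IsFlat V ↔ V = ⊤ := by
  refine ⟨fun h => ?_, fun h => h ▸ isFlat_top _⟩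
  exact (Submodule.eq_top_iff').2 fun x => (isFlat_iff _ V).1 h x rfl

/-- The free `q`-matroid, whose rank function is the dimension. -/
noncomputable def freeMatroid (F : Type u) [Field F] (E : Type u) [AddCommGroup E] [Module F E]
    [FiniteDimensional F E] : QMatroid F E where
  rank V := Module.finrank F V
  rank_le_finrank _ := le_rfl
  rank_mono _ _ h := Submodule.finrank_mono h
  rank_submodular V W := (Submodule.finrank_sup_add_finrank_inf_eq V W).le

open Classical in
/-- The uniform `q`-matroid of rank one. -/
noncomputable def uniformOne (F : Type u) [Field F] (E : Type u) [AddCommGroup E] [Module F E]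
    [FiniteDimensional F E] : QMatroid F E where
  rank V := if V = ⊥ then 0 else 1
  rank_le_finrank V := by
    split_ifs with h
    · exact Nat.zero_le _
    · exact Submodule.one_le_finrank_iff.2 h
  rank_mono V W h := by
    by_cases hW : W = ⊥
    · simp [hW, le_bot_iff.1 (hW ▸ h)]
    · rw [if_neg hW]; split_ifs <;> omega
  rank_submodular V W := by
    by_cases hV : V = ⊥
    · simp [hV]
    by_cases hW : W = ⊥
    · simp [hW]
    rw [if_neg hV, if_neg hW]
    split_ifs <;> omega

/-- Every nonzero space already has the full rank one, so its closure is everything. A strong map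
out of this `q`-matroid therefore sends its whole domain into any flat that contains the image of
one nonzero vector. -/
theorem isFlat_uniformOne_iff [FiniteDimensional F E] {V : Submodule F E} :
    (uniformOne F E).IsFlat V ↔ V = ⊥ ∨ V = ⊤ := by
  rw [isFlat_iff]
  constructor
  · intro h
    refine or_iff_not_imp_left.2 fun hV => Submodule.eq_top_iff'.2 fun x => h x ?_
    have : V ⊔ F ∙ x ≠ ⊥ := fun he => hV (le_bot_iff.1 (he ▸ le_sup_left))
    simp only [uniformOne, if_neg hV, if_neg this]
  · rintro (rfl | rfl) x hx
    · by_contra hx0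
      have : F ∙ x ≠ ⊥ := fun he => hx0 (Submodule.span_singleton_eq_bot.1 he)
      simp [uniformOne] at hx
      exact hx0 (by simpa using hx)
    · trivial

/-- `V` has dimension at most one or lies in a member of `S`. -/
def IsSpreadSmall (S : Set (Submodule F E)) (V : Submodule F E) : Prop :=
  Module.finrank F V ≤ 1 ∨ ∃ s ∈ S, V ≤ s

variable {S : Set (Submodule F E)} {V W : Submodule F E}

open Classical in
/-- The rank function of the `q`-matroid of rank at most two given by a partial spread `S`. -/
noncomputable def spreadRank (S : Set (Submodule F E)) (V : Submodule F E) : ℕ :=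
  if V = ⊥ then 0 else if IsSpreadSmall S V then 1 else 2

theorem spreadRank_le_two : spreadRank S V ≤ 2 := by
  unfold spreadRank; split_ifs <;> omega

theorem spreadRank_eq_one (h : V ≠ ⊥) (h' : IsSpreadSmall S V) : spreadRank S V = 1 := by
  rw [spreadRank, if_neg h, if_pos h']

theorem spreadRank_eq_two (h' : ¬ IsSpreadSmall S V) : spreadRank S V = 2 := by
  rw [spreadRank, if_neg, if_neg h']
  rintro rfl
  exact h' (.inl (by simp))

theorem spreadRank_bot : spreadRank S (⊥ : Submodule F E) = 0 := if_pos rfl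

variable [FiniteDimensional F E]

theorem IsSpreadSmall.mono (hW : IsSpreadSmall S W) (h : V ≤ W) : IsSpreadSmall S V := by
  obtain hW | ⟨s, hs, hWs⟩ := hW
  · exact .inl ((Submodule.finrank_mono h).trans hW)
  · exact .inr ⟨s, hs, h.trans hWs⟩

theorem le_of_finrank_le_one_of_inf_ne_bot (hV : Module.finrank F V ≤ 1) (h : V ⊓ W ≠ ⊥) :
    V ≤ W :=
  inf_eq_left.1 (Submodule.eq_of_le_of_finrank_le inf_le_left
    (hV.trans (Submodule.one_le_finrank_iff.2 h)))

/-- This is the only place where submodularity of the spread rank needs the partial spread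
condition: members of `S` containing `V` and `W` meet nontrivially, hence coincide. -/
theorem IsSpreadSmall.sup (hS : ∀ s ∈ S, ∀ t ∈ S, s ⊓ t ≠ ⊥ → s = t)
    (hV : IsSpreadSmall S V) (hW : IsSpreadSmall S W) (h : V ⊓ W ≠ ⊥) :
    IsSpreadSmall S (V ⊔ W) := by
  obtain hV | ⟨s, hs, hVs⟩ := hV
  · rwa [sup_eq_right.2 (le_of_finrank_le_one_of_inf_ne_bot hV h)]
  obtain hW | ⟨t, ht, hWt⟩ := hW
  · rw [inf_comm] at h
    rw [sup_eq_left.2 (le_of_finrank_le_one_of_inf_ne_bot hW h)]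
    exact .inr ⟨s, hs, hVs⟩
  · obtain rfl := hS s hs t ht fun he => h (le_bot_iff.1 (he ▸ inf_le_inf hVs hWt))
    exact .inr ⟨s, hs, sup_le hVs hWt⟩

theorem spreadRank_mono (h : V ≤ W) : spreadRank S V ≤ spreadRank S W := by
  by_cases hV : V = ⊥
  · rw [hV, spreadRank_bot]; exact Nat.zero_le _
  have hW : W ≠ ⊥ := fun he => hV (le_bot_iff.1 (he ▸ h))
  by_cases hW' : IsSpreadSmall S W
  · rw [spreadRank_eq_one hW hW', spreadRank_eq_one hV (hW'.mono h)]
  · rw [spreadRank_eq_two hW']; exact spreadRank_le_two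

/-- The `q`-matroid whose flats of rank one are the members of the partial spread `S` and the
one-dimensional spaces that they do not contain. -/
noncomputable def spreadMatroid (S : Set (Submodule F E))
    (hS : ∀ s ∈ S, ∀ t ∈ S, s ⊓ t ≠ ⊥ → s = t) : QMatroid F E where
  rank := spreadRank S
  rank_le_finrank V := by
    by_cases hV : V = ⊥
    · simp [hV, spreadRank_bot]
    by_cases hV' : IsSpreadSmall S V
    · rw [spreadRank_eq_one hV hV']
      exact Submodule.one_le_finrank_iff.2 hV
    · rw [spreadRank_eq_two hV']
      by_contra! h
      exact hV' (.inl (by omega))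
  rank_mono _ _ := spreadRank_mono
  rank_submodular V W := by
    by_cases hV : V = ⊥
    · simp [hV, spreadRank_bot]
    by_cases hW : W = ⊥
    · simp [hW, spreadRank_bot]
    have h₂ : spreadRank S (V ⊔ W) ≤ 2 := spreadRank_le_two
    have hVW := spreadRank_mono (S := S) (inf_le_left : V ⊓ W ≤ V)
    have hWV := spreadRank_mono (S := S) (inf_le_right : V ⊓ W ≤ W)
    -- If one of the two spaces has rank two, the bound two on the sum and monotonicity on the
    -- intersection suffice. The real case is that of two small spaces with nonzero intersection.
    by_cases hV' : IsSpreadSmall S V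
    · by_cases hW' : IsSpreadSmall S W
      · by_cases h : V ⊓ W = ⊥
        · rw [h, spreadRank_bot, spreadRank_eq_one hV hV', spreadRank_eq_one hW hW']
          omega
        · rw [spreadRank_eq_one hV hV'] at hVW ⊢
          rw [spreadRank_eq_one hW hW', spreadRank_eq_one _ (hV'.sup hS hW' h)]
          · omega
          · exact fun he => hV (le_bot_iff.1 (he ▸ le_sup_left))
      · rw [spreadRank_eq_two hW']
        omega
    · rw [spreadRank_eq_two hV']
      omega

variable {hS : ∀ s ∈ S, ∀ t ∈ S, s ⊓ t ≠ ⊥ → s = t}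

/-- An extension of `V` that still has rank one either is a line, hence equal to `V`, or lies in a
member of `S`, which meets `V` and so is `V`. -/
theorem isFlat_spreadMatroid_of_mem (hV : V ∈ S) (h0 : V ≠ ⊥) :
    (spreadMatroid S hS).IsFlat V := by
  refine (isFlat_iff _ V).2 fun x hx => ?_
  have hx' : spreadRank S (V ⊔ F ∙ x) = spreadRank S V := hx
  rw [spreadRank_eq_one h0 (.inr ⟨V, hV, le_rfl⟩)] at hx'
  have hle : V ⊔ F ∙ x ≤ V := by
    by_cases h : IsSpreadSmall S (V ⊔ F ∙ x)
    · obtain h | ⟨s, hs, h⟩ := h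
      · refine le_of_finrank_le_one_of_inf_ne_bot h ?_
        rwa [inf_eq_right.2 le_sup_left]
      · have hVs := le_sup_left.trans h
        rwa [hS V hV s hs (by rwa [inf_eq_left.2 hVs])] at h ⊢
    · rw [spreadRank_eq_two h] at hx'
      omega
  exact hle (le_sup_right (a := V) (Submodule.mem_span_singleton_self x))

theorem isFlat_spreadMatroid_span {x : E} (h0 : x ≠ 0) (h : ∀ s ∈ S, x ∉ s) :
    (spreadMatroid S hS).IsFlat (F ∙ x) := by
  refine (isFlat_iff _ _).2 fun y hy => ?_
  have hy' : spreadRank S (F ∙ x ⊔ F ∙ y) = spreadRank S (F ∙ x) := hy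
  have h0' : F ∙ x ≠ ⊥ := fun he => h0 (Submodule.span_singleton_eq_bot.1 he)
  rw [spreadRank_eq_one h0' (.inl (finrank_span_singleton h0).le)] at hy'
  by_cases hs : IsSpreadSmall S (F ∙ x ⊔ F ∙ y)
  · obtain hs | ⟨s, hs, hle⟩ := hs
    · have := le_of_finrank_le_one_of_inf_ne_bot (W := F ∙ x) hs
        (by rwa [inf_eq_right.2 le_sup_left])
      exact this (le_sup_right (a := F ∙ x) (Submodule.mem_span_singleton_self y))
    · exact absurd (hle (le_sup_left (b := F ∙ y) (Submodule.mem_span_singleton_self x)))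
        (h s hs)
  · rw [spreadRank_eq_two hs] at hy'
    omega

/-- The range of `f` has rank one, so a flat containing one nonzero vector of it contains all of it.
Preimages of flats are thus zero or everything. -/
theorem isStrong_uniformOne_spreadMatroid [FiniteDimensional F E'] {f : E' →ₗ[F] E}
    (hf : Function.Injective f) (hfS : LinearMap.range f ∈ S) :
    (LMap.ofLinear f).IsStrong (uniformOne F E') (spreadMatroid S hS) := by
  refine fun Z hZ => ⟨Z.comap f, isFlat_uniformOne_iff.2 ?_, rfl⟩
  refine or_iff_not_imp_left.2 fun h => Submodule.eq_top_iff'.2 fun y => ?_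
  obtain ⟨x, hx, hx0⟩ := Submodule.exists_mem_ne_zero_of_ne_bot h
  refine (isFlat_iff _ Z).1 hZ _ (rank_sup_eq_of_le _ (V := F ∙ f x)
    ((Submodule.span_singleton_le_iff_mem _ _).2 hx) ?_)
  have h0 : F ∙ f x ≠ ⊥ := fun he =>
    hx0 (hf (by rw [map_zero]; exact Submodule.span_singleton_eq_bot.1 he))
  have hle : ∀ z, F ∙ f z ≤ LinearMap.range f := fun z =>
    (Submodule.span_singleton_le_iff_mem _ _).2 ⟨z, rfl⟩
  change spreadRank S _ = spreadRank S _
  rw [spreadRank_eq_one h0 (.inr ⟨_, hfS, hle x⟩), spreadRank_eq_one _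
    (.inr ⟨_, hfS, sup_le (hle x) (hle y)⟩)]
  exact fun he => h0 (le_bot_iff.1 (he ▸ le_sup_left))

end QMatroid

/-! ### `𝓛`-maps and `𝓛`-classes -/

section FieldTwo

variable {F : Type u} [Field F] {E₁ E₂ : Type u} [AddCommGroup E₁] [Module F E₁]
  [AddCommGroup E₂] [Module F E₂]

theorem eq_zero_or_one_of_card_eq_two (hF : Nat.card F = 2) (c : F) : c = 0 ∨ c = 1 := by
  by_contra! h
  obtain ⟨y, -, hy⟩ := (Nat.card_eq_two_iff' (0 : F)).1 hF
  exact h.2 ((hy c h.1).trans (hy 1 one_ne_zero).symm)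

theorem mem_span_singleton_of_card_eq_two (hF : Nat.card F = 2) {x y : E₁} :
    y ∈ F ∙ x ↔ y = 0 ∨ y = x := by
  rw [Submodule.mem_span_singleton]
  constructor
  · rintro ⟨c, rfl⟩
    obtain rfl | rfl := eq_zero_or_one_of_card_eq_two hF c <;> simp
  · rintro (rfl | rfl)
    · exact ⟨0, zero_smul _ _⟩
    · exact ⟨1, one_smul _ _⟩

theorem add_self_of_card_eq_two (hF : Nat.card F = 2) (x : E₁) : x + x = 0 := by
  have h : (1 : F) + 1 = 0 := by
    obtain h | h := eq_zero_or_one_of_card_eq_two hF (1 + 1)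
    · exact h
    · exact absurd (add_eq_left.1 h) one_ne_zero
  rw [← two_smul F x, ← one_add_one_eq_two, h, zero_smul]

theorem LMap.map_zero (φ : LMap F E₁ E₂) : φ.toFun 0 = 0 := by
  have h : (0 : E₂) ∈ φ.induced ⊥ := zero_mem _
  obtain ⟨x, hx, h⟩ := h
  rwa [(Submodule.mem_bot F).1 hx] at h

/-- The line through `x` is `{0, x}`, so its image `{0, φ x}` determines `φ x`. -/
theorem LMap.eq_of_induced_eq (hF : Nat.card F = 2) {φ ψ : LMap F E₁ E₂}
    (h : φ.induced = ψ.induced) : φ = ψ := by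
  -- Only half of the equality follows from one inclusion; the case `φ x = 0` is settled by
  -- exchanging the two maps.
  have key : ∀ {φ ψ : LMap F E₁ E₂}, φ.induced = ψ.induced → ∀ x,
      φ.toFun x = 0 ∨ φ.toFun x = ψ.toFun x := by
    intro φ ψ h x
    have hx : φ.toFun x ∈ φ.induced (F ∙ x) := ⟨x, Submodule.mem_span_singleton_self x, rfl⟩
    rw [h] at hx
    obtain ⟨y, hy, hyx⟩ := hx
    obtain rfl | rfl := (mem_span_singleton_of_card_eq_two hF).1 hy
    · exact .inl (by rw [← hyx, LMap.map_zero])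
    · exact .inr hyx.symm
  ext x
  obtain h₁ | h₁ := key h x
  · obtain h₂ | h₂ := key h.symm x
    · rw [h₁, h₂]
    · exact h₂.symm
  · exact h₁

theorem LClass.mk_injective (hF : Nat.card F = 2) :
    Function.Injective (LClass.mk : LMap F E₁ E₂ → LClass F E₁ E₂) :=
  fun _ _ h => LMap.eq_of_induced_eq hF (LClass.mk_eq_mk.1 h)

/-- Over the field with two elements, every zero-preserving map to `F` is an `𝓛`-map. -/
def LMap.ofMapZero (hF : Nat.card F = 2) (f : E₁ → F) (hf : f 0 = 0) : LMap F E₁ F where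
  toFun := f
  image_isSubspace V := by
    -- The image contains `0`, and the only such subsets of the two-element field are `{0}` and `F`,
    -- both subspaces.
    by_cases h : ∀ x ∈ V, f x = 0
    · refine ⟨⊥, Set.ext fun y => ⟨?_, ?_⟩⟩
      · rintro rfl
        exact ⟨0, V.zero_mem, hf⟩
      · rintro ⟨x, hx, rfl⟩
        exact h x hx
    · push Not at h
      obtain ⟨x, hx, h⟩ := h
      refine ⟨⊤, Set.ext fun y => ⟨fun _ => ?_, fun _ => trivial⟩⟩
      obtain rfl | rfl := eq_zero_or_one_of_card_eq_two hF y
      · exact ⟨0, V.zero_mem, hf⟩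
      · exact ⟨x, hx, (eq_zero_or_one_of_card_eq_two hF _).resolve_left h⟩

end FieldTwo

namespace LMap

variable {F : Type u} [Field F] {E₁ E₂ E₃ : Type u} [AddCommGroup E₁] [Module F E₁]
  [AddCommGroup E₂] [Module F E₂] [AddCommGroup E₃] [Module F E₃]

theorem induced_mono (φ : LMap F E₁ E₂) {V W : Submodule F E₁} (h : V ≤ W) :
    φ.induced V ≤ φ.induced W :=
  Set.image_mono h

theorem exists_ofLinear_eq {φ : LMap F E₁ E₂} (h : φ.IsLinear) :
    ∃ f : E₁ →ₗ[F] E₂, ofLinear f = φ :=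
  ⟨h.mk' _, rfl⟩

theorem isLinear_ofLinear (f : E₁ →ₗ[F] E₂) : (ofLinear f).IsLinear := f.isLinear

end LMap

/-- The types of morphisms consisting of linear classes. -/
def MapType.Linear : MapType → Prop
  | .strong => False
  | .rankPreserving => False
  | .weak => False
  | .linearStrong => True
  | .linearRankPreserving => True
  | .linearWeak => True

namespace LClass

variable {F : Type u} [Field F] {E E₁ E₂ : Type u} [AddCommGroup E₁] [Module F E₁]
  [AddCommGroup E₂] [Module F E₂] [AddCommGroup E] [Module F E] {Δ : MapType}

/-- If `M` has some morphism to a trivial `q`-matroid, then every `𝓛`-map from `M` to a trivial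
`q`-matroid gives a morphism, provided that it is linear in the linear cases. -/
theorem isOfType_trivialMatroid {M : QMatroid F E₁} {c : LClass F E₁ E}
    (hc : c.IsOfType Δ M (QMatroid.trivialMatroid F E)) {φ : LMap F E₁ E₂}
    (hφ : Δ.Linear → φ.IsLinear) :
    (mk φ).IsOfType Δ M (QMatroid.trivialMatroid F E₂) := by
  have hs : (mk φ).IsStrong M (QMatroid.trivialMatroid F E₂) :=
    ⟨φ, rfl, fun W hW => ⟨⊤, M.isFlat_top, by
      rw [QMatroid.isFlat_trivialMatroid_iff.1 hW]; rfl⟩⟩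
  have hw : (mk φ).IsWeak M (QMatroid.trivialMatroid F E₂) :=
    ⟨φ, rfl, fun V => Nat.zero_le _⟩
  -- A rank-preserving class into a trivial `q`-matroid forces `M` itself to have rank zero, and
  -- then any map between the two preserves rank.
  have hr : c.IsRankPreserving M (QMatroid.trivialMatroid F E) →
      (mk φ).IsRankPreserving M (QMatroid.trivialMatroid F E₂) :=
    fun ⟨_, _, h⟩ => ⟨φ, rfl, fun V => h V⟩
  have hl : Δ.Linear → (mk φ).IsLinear := fun h => ⟨φ, rfl, hφ h⟩
  cases Δ with
  | strong => exact hs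
  | rankPreserving => exact hr hc
  | weak => exact hw
  | linearStrong => exact ⟨hl trivial, hs⟩
  | linearRankPreserving => exact ⟨hl trivial, hr hc.2⟩
  | linearWeak => exact ⟨hl trivial, hw⟩

end LClass

/-! ### Morphisms into trivial `q`-matroids, and composites computed on representatives -/

namespace QMatCat

variable {F : Type u} [Field F] {Δ : MapType}

/-- The trivial `q`-matroid on `E` as an object of `q-Mat^[Δ]`. -/
noncomputable def trivialObj (F : Type u) [Field F] (Δ : MapType) (E : Type u) [AddCommGroup E]
    [Module F E] [FiniteDimensional F E] : QMatCat F Δ where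
  carrier := E
  matroid := QMatroid.trivialMatroid F E

section Trivial

variable {E E₁ E₂ : Type u} [AddCommGroup E] [Module F E] [FiniteDimensional F E]
  [AddCommGroup E₁] [Module F E₁] [FiniteDimensional F E₁]
  [AddCommGroup E₂] [Module F E₂] [FiniteDimensional F E₂]

/-- The morphism to a trivial `q`-matroid given by an `𝓛`-map. -/
noncomputable def homTrivial {M : QMatCat F Δ} (c : M ⟶ trivialObj F Δ E)
    (φ : LMap F M.carrier E₂) (hφ : Δ.Linear → φ.IsLinear) : M ⟶ trivialObj F Δ E₂ :=
  Hom.mk (N := trivialObj F Δ E₂) (LClass.mk φ) (LClass.isOfType_trivialMatroid c.isOfType hφ)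

/-- The morphism between trivial `q`-matroids given by a linear map. -/
noncomputable def linearTrivial (Δ : MapType) (f : E₁ →ₗ[F] E₂) :
    trivialObj F Δ E₁ ⟶ trivialObj F Δ E₂ :=
  homTrivial (𝟙 (trivialObj F Δ E₁)) (LMap.ofLinear f) fun _ => LMap.isLinear_ofLinear f

end Trivial

theorem comp_cls {M N P : QMatCat F Δ} (f : M ⟶ N) (g : N ⟶ P) :
    (f ≫ g).cls = g.cls.comp f.cls := rfl

theorem exists_rep {M N : QMatCat F Δ} (f : M ⟶ N) :
    ∃ φ : LMap F M.carrier N.carrier, LClass.mk φ = f.cls :=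
  Quotient.exists_rep f.cls

/-- The action of a composite on subspaces, in terms of representatives. -/
theorem induced_of_comp_eq {M N P : QMatCat F Δ} {f : M ⟶ N} {g : N ⟶ P} {h : M ⟶ P}
    (e : f ≫ g = h) {φ : LMap F M.carrier N.carrier} {ψ : LMap F N.carrier P.carrier}
    {χ : LMap F M.carrier P.carrier} (hφ : LClass.mk φ = f.cls) (hψ : LClass.mk ψ = g.cls)
    (hχ : LClass.mk χ = h.cls) (V : Submodule F M.carrier) :
    ψ.induced (φ.induced V) = χ.induced V := by
  rw [← LMap.induced_comp]
  refine congrFun (LClass.mk_eq_mk.1 ?_) V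
  rw [hχ, ← e, comp_cls, ← hφ, ← hψ, LClass.comp_mk]

/-- Since classes are single maps over the two-element field, a factorization in the category can be
evaluated at vectors and not only at subspaces. -/
theorem toFun_of_comp_eq (hF : Nat.card F = 2) {M N P : QMatCat F Δ} {f : M ⟶ N} {g : N ⟶ P}
    {h : M ⟶ P} (e : f ≫ g = h) {φ : LMap F M.carrier N.carrier}
    {ψ : LMap F N.carrier P.carrier} {χ : LMap F M.carrier P.carrier}
    (hφ : LClass.mk φ = f.cls) (hψ : LClass.mk ψ = g.cls) (hχ : LClass.mk χ = h.cls)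
    (x : M.carrier) : ψ.toFun (φ.toFun x) = χ.toFun x := by
  have : ψ.comp φ = χ := LClass.mk_injective hF (by
    rw [hχ, ← e, comp_cls, ← hφ, ← hψ, LClass.comp_mk])
  exact congrFun (congrArg LMap.toFun this) x

theorem hom_ext_of_comp {M N P : QMatCat F Δ} {f : M ⟶ N} {g g' : N ⟶ P}
    {φ : LMap F M.carrier N.carrier} {ψ ψ' : LMap F N.carrier P.carrier}
    (hφ : LClass.mk φ = f.cls) (hψ : LClass.mk ψ = g.cls) (hψ' : LClass.mk ψ' = g'.cls)
    (h : ∀ x, ψ.toFun (φ.toFun x) = ψ'.toFun (φ.toFun x)) : f ≫ g = f ≫ g' := by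
  refine Hom.ext ?_
  rw [comp_cls, comp_cls, ← hφ, ← hψ, ← hψ', LClass.comp_mk, LClass.comp_mk]
  exact congrArg _ (LMap.ext (funext h))

end QMatCat

namespace QMatCat

variable {F : Type u} [Field F]

/-! ### Fields with more than two elements -/

/-- Scaling one axis is invisible to the classes of the two embeddings, but it moves the line of
`(1, 1)`. Between trivial `q`-matroids every linear map is a morphism of every type, so one example
serves all six categories. -/
theorem not_hasBinaryCoproducts_of_card_ne_two [Finite F] (hF : Nat.card F ≠ 2) (Δ : MapType) :
    ¬ HasBinaryCoproducts (QMatCat F Δ) := by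
  intro _
  obtain ⟨c, hc0, hc1⟩ : ∃ c : F, c ≠ 0 ∧ c ≠ 1 := by
    by_contra! h
    exact hF ((Nat.card_eq_two_iff' (0 : F)).2 ⟨1, one_ne_zero, fun y hy => h y hy⟩)
  let T := trivialObj F Δ F
  let f₁ : T ⟶ trivialObj F Δ (F × F) := linearTrivial Δ (LinearMap.inl F F F)
  let f₂ : T ⟶ trivialObj F Δ (F × F) := linearTrivial Δ (LinearMap.inr F F F)
  let D : F × F →ₗ[F] F × F := LinearMap.prodMap LinearMap.id (c • LinearMap.id)
  let d : trivialObj F Δ (F × F) ⟶ trivialObj F Δ (F × F) := linearTrivial Δ D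
  have h₁ : f₁ ≫ d = f₁ := Hom.ext (LClass.mk_eq_mk.2 (by
    have : D ∘ₗ LinearMap.inl F F F = LinearMap.inl F F F := by ext <;> simp [D]
    exact congrArg (fun f : F →ₗ[F] F × F => (LMap.ofLinear f).induced) this))
  -- As maps these differ by the factor `c`; the classes agree because scaling by `c ≠ 0` fixes
  -- every subspace.
  have h₂ : f₂ ≫ d = f₂ := Hom.ext (LClass.mk_eq_mk.2 (by
    have : D ∘ₗ LinearMap.inr F F F = c • LinearMap.inr F F F := by ext <;> simp [D]
    exact (congrArg (fun f : F →ₗ[F] F × F => (LMap.ofLinear f).induced) this).trans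
      (funext fun V => Submodule.map_smul _ V c hc0)))
  let u : T ⨿ T ⟶ trivialObj F Δ (F × F) := coprod.desc f₁ f₂
  have hu : u ≫ d = u := by
    refine coprod.hom_ext ?_ ?_
    · rw [coprod.inl_desc_assoc, coprod.inl_desc, h₁]
    · rw [coprod.inr_desc_assoc, coprod.inr_desc, h₂]
  obtain ⟨φ, hφ⟩ := exists_rep u
  obtain ⟨α, hα⟩ := exists_rep (coprod.inl : T ⟶ T ⨿ T)
  obtain ⟨β, hβ⟩ := exists_rep (coprod.inr : T ⟶ T ⨿ T)
  have e₁ : ((1, 0) : F × F) ∈ φ.induced ⊤ := by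
    have := induced_of_comp_eq (coprod.inl_desc f₁ f₂) hα hφ
      (χ := LMap.ofLinear (LinearMap.inl F F F)) rfl ⊤
    exact φ.induced_mono le_top ((SetLike.ext_iff.1 this _).2 ⟨(1 : F), trivial, rfl⟩)
  have e₂ : ((0, 1) : F × F) ∈ φ.induced ⊤ := by
    have := induced_of_comp_eq (coprod.inr_desc f₁ f₂) hβ hφ
      (χ := LMap.ofLinear (LinearMap.inr F F F)) rfl ⊤
    exact φ.induced_mono le_top ((SetLike.ext_iff.1 this _).2 ⟨(1 : F), trivial, rfl⟩)
  -- The representative `φ` need not be additive, so a preimage of `(1, 1)` is taken from the fact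
  -- that the image of the whole space is a subspace.
  obtain ⟨p, -, hp⟩ := (φ.induced ⊤).add_mem e₁ e₂
  set W : Submodule F (F × F) := φ.induced (F ∙ p) with hW
  have hDW : W.map D = W := induced_of_comp_eq hu hφ (ψ := LMap.ofLinear D) rfl hφ (F ∙ p)
  have h11 : ((1, 1) : F × F) ∈ W :=
    ⟨p, Submodule.mem_span_singleton_self p, hp.trans (Prod.ext (add_zero (1 : F)) (zero_add (1 : F)))⟩
  have h1c : ((1, c) : F × F) ∈ W := by
    rw [← hDW]
    exact ⟨(1, 1), h11, by simp [D]⟩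
  -- Here `c ≠ 1` is used: the difference of `(1, c)` and `(1, 1)` is a nonzero multiple of `(0,
  -- 1)`.
  have h01 : ((0, 1) : F × F) ∈ W := by
    have := W.smul_mem (c - 1)⁻¹ (W.sub_mem h1c h11)
    simpa [inv_mul_cancel₀ (sub_ne_zero.2 hc1)] using this
  have htop : ∀ y : F × F, y ∈ W := fun y => by
    have := W.add_mem (W.smul_mem y.1 h11) (W.smul_mem (y.2 - y.1) h01)
    simpa using this
  have hsurj : Function.Surjective fun a : F => φ.toFun (a • p) := fun y => by
    obtain ⟨z, hz, hzy⟩ := htop y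
    obtain ⟨a, rfl⟩ := Submodule.mem_span_singleton.1 hz
    exact ⟨a, hzy⟩
  have hcard : Nat.card (F × F) ≤ Nat.card F := Nat.card_le_card_of_surjective _ hsurj
  rw [Nat.card_prod] at hcard
  have := Finite.one_lt_card (α := F)
  nlinarith

/-! ### Nonlinear morphisms over the field with two elements -/

/-- The generators `a` and `b` of the two summands are distinct and nonzero, so `a + b` is a nonzero
vector outside both images `{0, a}` and `{0, b}`. Two zero-preserving maps to `F` that differ only
at `a + b` restrict to the same morphisms on both summands. -/
theorem not_hasBinaryCoproducts_of_not_linear (hF : Nat.card F = 2) {Δ : MapType}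
    (hΔ : ¬ Δ.Linear) : ¬ HasBinaryCoproducts (QMatCat F Δ) := by
  classical
  intro _
  let T := trivialObj F Δ F
  obtain ⟨α, hα⟩ := exists_rep (coprod.inl : T ⟶ T ⨿ T)
  obtain ⟨β, hβ⟩ := exists_rep (coprod.inr : T ⟶ T ⨿ T)
  let z : T ⟶ T := linearTrivial Δ (0 : F →ₗ[F] F)
  let a : (T ⨿ T).carrier := α.toFun (1 : F)
  let b : (T ⨿ T).carrier := β.toFun (1 : F)
  have key : ∃ u : (T ⨿ T).carrier → F, u 0 = 0 ∧ u a = 1 ∧ u b = 0 := by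
    obtain ⟨φ, hφ⟩ := exists_rep (coprod.desc (𝟙 T) z)
    exact ⟨φ.toFun, φ.map_zero,
      toFun_of_comp_eq hF (coprod.inl_desc (𝟙 T) z) hα hφ (χ := LMap.id F F) rfl (1 : F),
      toFun_of_comp_eq hF (coprod.inr_desc (𝟙 T) z) hβ hφ (χ := LMap.ofLinear 0) rfl (1 : F)⟩
  have key' : ∃ u : (T ⨿ T).carrier → F, u 0 = 0 ∧ u b = 1 := by
    obtain ⟨φ, hφ⟩ := exists_rep (coprod.desc z (𝟙 T))
    exact ⟨φ.toFun, φ.map_zero,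
      toFun_of_comp_eq hF (coprod.inr_desc z (𝟙 T)) hβ hφ (χ := LMap.id F F) rfl (1 : F)⟩
  obtain ⟨u, hu0, hua, hub⟩ := key
  obtain ⟨v, hv0, hvb⟩ := key'
  have ha : a ≠ 0 := fun h => one_ne_zero (α := F) (by rw [← hua, h, hu0])
  have hb : b ≠ 0 := fun h => one_ne_zero (α := F) (by rw [← hvb, h, hv0])
  have hab : a ≠ b := fun h => one_ne_zero (α := F) (by rw [← hua, h, hub])
  have hab0 : a + b ≠ 0 := fun h =>
    hab (add_right_cancel (h.trans (add_self_of_card_eq_two hF b).symm))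
  let φ : LMap F (T ⨿ T).carrier F :=
    LMap.ofMapZero hF (fun x => if x = 0 then 0 else 1) (if_pos rfl)
  let ψ : LMap F (T ⨿ T).carrier F :=
    LMap.ofMapZero hF (fun x => if x = 0 ∨ x = a + b then 0 else 1) (if_pos (.inl rfl))
  -- The codiagonal serves only as a witness that some morphism from the coproduct to a trivial
  -- `q`-matroid exists.
  let f : T ⨿ T ⟶ T := homTrivial (coprod.desc (𝟙 T) (𝟙 T)) φ fun h => absurd h hΔ
  let g : T ⨿ T ⟶ T := homTrivial (coprod.desc (𝟙 T) (𝟙 T)) ψ fun h => absurd h hΔ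
  have agree : ∀ (χ : LMap F F (T ⨿ T).carrier), χ.toFun 1 ≠ a + b → ∀ x : F,
      φ.toFun (χ.toFun x) = ψ.toFun (χ.toFun x) := by
    intro χ hχ x
    obtain rfl | rfl := eq_zero_or_one_of_card_eq_two hF x
    · rw [χ.map_zero, φ.map_zero, ψ.map_zero]
    · simp only [φ, ψ, LMap.ofMapZero, hχ, or_false]
  have hfg : f = g := by
    refine coprod.hom_ext (hom_ext_of_comp hα rfl rfl (agree α ?_))
      (hom_ext_of_comp hβ rfl rfl (agree β ?_))
    · exact fun h => hb (left_eq_add.1 h)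
    · exact fun h => ha (right_eq_add.1 h)
  have hφψ : φ = ψ := LClass.mk_injective hF (congrArg Hom.cls hfg)
  have := congrFun (congrArg LMap.toFun hφψ) (a + b)
  simp [φ, ψ, LMap.ofMapZero, hab0] at this

/-! ### Linear rank-preserving morphisms -/

theorem not_hasBinaryCoproducts_linearRankPreserving :
    ¬ HasBinaryCoproducts (QMatCat F .linearRankPreserving) := by
  intro _
  let T : QMatCat F .linearRankPreserving := ⟨F, QMatroid.freeMatroid F F⟩
  let N : QMatCat F .linearRankPreserving := ⟨F × F, QMatroid.freeMatroid F (F × F)⟩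
  have hinj : ∀ f : F →ₗ[F] F × F, Function.Injective f →
      (LClass.mk (LMap.ofLinear f)).IsOfType .linearRankPreserving T.matroid N.matroid :=
    fun f hf => ⟨⟨_, rfl, LMap.isLinear_ofLinear f⟩,
      ⟨_, rfl, fun V => (Submodule.equivMapOfInjective f hf V).finrank_eq.symm⟩⟩
  let f₁ : T ⟶ N := Hom.mk (N := N) _ (hinj (LinearMap.inl F F F) LinearMap.inl_injective)
  let f₂ : T ⟶ N := Hom.mk (N := N) _ (hinj (LinearMap.inr F F F) LinearMap.inr_injective)
  obtain ⟨-, φ, -, hφ⟩ := (coprod.desc (𝟙 T) (𝟙 T)).isOfType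
  obtain ⟨-, ψ, hψ, hψ'⟩ := (coprod.desc f₁ f₂).isOfType
  obtain ⟨α, hα⟩ := exists_rep (coprod.inl : T ⟶ T ⨿ T)
  obtain ⟨β, hβ⟩ := exists_rep (coprod.inr : T ⟶ T ⨿ T)
  -- The codiagonal preserves rank, and its target has dimension one.
  have h₁ : (T ⨿ T).matroid.rank ⊤ ≤ 1 := by
    rw [← hφ ⊤]
    exact (Submodule.finrank_le (R := F) (M := F) _).trans (Module.finrank_self F).le
  have e₁ : ((1, 0) : F × F) ∈ ψ.induced ⊤ := by
    have := induced_of_comp_eq (coprod.inl_desc f₁ f₂) hα hψ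
      (χ := LMap.ofLinear (LinearMap.inl F F F)) rfl ⊤
    exact ψ.induced_mono le_top ((SetLike.ext_iff.1 this _).2 ⟨(1 : F), trivial, rfl⟩)
  have e₂ : ((0, 1) : F × F) ∈ ψ.induced ⊤ := by
    have := induced_of_comp_eq (coprod.inr_desc f₁ f₂) hβ hψ
      (χ := LMap.ofLinear (LinearMap.inr F F F)) rfl ⊤
    exact ψ.induced_mono le_top ((SetLike.ext_iff.1 this _).2 ⟨(1 : F), trivial, rfl⟩)
  have htop : ψ.induced ⊤ = ⊤ := by
    refine Submodule.eq_top_iff'.2 fun (y : F × F) => ?_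
    have := (ψ.induced ⊤).add_mem ((ψ.induced ⊤).smul_mem y.1 e₁)
      ((ψ.induced ⊤).smul_mem y.2 e₂)
    have hy : y = y.1 • ((1, 0) : F × F) + y.2 • ((0, 1) : F × F) := by ext <;> simp
    rw [hy]
    exact this
  have h₂ : (T ⨿ T).matroid.rank ⊤ = 2 := by
    rw [← hψ' ⊤, htop]
    change Module.finrank F (⊤ : Submodule F (F × F)) = 2
    rw [finrank_top, Module.finrank_prod, Module.finrank_self]
  omega

/-! ### Linear strong morphisms over the field with two elements -/

/-- Linearity and strength of a class are witnessed by possibly different representatives, which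
coincide over the two-element field. -/
theorem exists_linear_rep {M N : QMatCat F .linearStrong} (hF : Nat.card F = 2) (f : M ⟶ N) :
    ∃ g : M.carrier →ₗ[F] N.carrier, LClass.mk (LMap.ofLinear g) = f.cls ∧
      (LMap.ofLinear g).IsStrong M.matroid N.matroid := by
  obtain ⟨⟨φ, hφ, hl⟩, ψ, hψ, hs⟩ := f.isOfType
  obtain rfl : φ = ψ := LClass.mk_injective hF (hφ.trans hψ.symm)
  obtain ⟨g, rfl⟩ := LMap.exists_ofLinear_eq hl
  exact ⟨g, hφ, hs⟩

/-- Let `x`, `w` be the diagonal vectors of `e₁`, `e₂` in the coproduct and `t = α e₁`. In `N` the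
line of `(e₁, e₁)` is a flat, so `w` adds rank to `x`; in `N'` the diagonal is a flat, so `t` adds
rank to `x, w`. Hence `x, w, t` have rank at least two more than `x`. But a flat containing `x` and
`t` contains both summands, hence also `w`, and there is one whose rank is at most one more than
that of `x`. -/
theorem not_hasBinaryCoproducts_linearStrong (hF : Nat.card F = 2) :
    ¬ HasBinaryCoproducts (QMatCat F .linearStrong) := by
  intro _
  let E := F × F
  let ι₁ := LinearMap.inl F E E
  let ι₂ := LinearMap.inr F E E
  let δ : E →ₗ[F] E × E := LinearMap.prod LinearMap.id LinearMap.id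
  let S : Set (Submodule F (E × E)) := {ι₁.range, ι₂.range}
  let S' : Set (Submodule F (E × E)) := {ι₁.range, ι₂.range, δ.range}
  have d₁₂ : ι₁.range ⊓ ι₂.range = ⊥ := by
    refine (Submodule.eq_bot_iff _).2 ?_
    rintro _ ⟨⟨x, rfl⟩, y, h⟩
    simp only [ι₁, ι₂, LinearMap.inl_apply, LinearMap.inr_apply, Prod.mk.injEq] at h ⊢
    simp [← h.1]
  have d₁ : ι₁.range ⊓ δ.range = ⊥ := by
    refine (Submodule.eq_bot_iff _).2 ?_
    rintro _ ⟨⟨x, rfl⟩, y, h⟩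
    have h' : (y, y) = (x, (0 : E)) := h
    have hx : x = 0 := (congrArg Prod.fst h').symm.trans (congrArg Prod.snd h')
    rw [hx, map_zero]
  have d₂ : ι₂.range ⊓ δ.range = ⊥ := by
    refine (Submodule.eq_bot_iff _).2 ?_
    rintro _ ⟨⟨x, rfl⟩, y, h⟩
    have h' : (y, y) = ((0 : E), x) := h
    have hx : x = 0 := (congrArg Prod.snd h').symm.trans (congrArg Prod.fst h')
    rw [hx, map_zero]
  have hS' : ∀ s ∈ S', ∀ t ∈ S', s ⊓ t ≠ ⊥ → s = t := by
    rintro s (rfl | rfl | rfl) t (rfl | rfl | rfl) h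
    · rfl
    · exact absurd d₁₂ h
    · exact absurd d₁ h
    · exact absurd (inf_comm _ _ |>.trans d₁₂) h
    · rfl
    · exact absurd d₂ h
    · exact absurd (inf_comm _ _ |>.trans d₁) h
    · exact absurd (inf_comm _ _ |>.trans d₂) h
    · rfl
  have hSS' : S ⊆ S' := by
    rintro s (rfl | rfl)
    · exact .inl rfl
    · exact .inr (.inl rfl)
  have hS : ∀ s ∈ S, ∀ t ∈ S, s ⊓ t ≠ ⊥ → s = t :=
    fun s hs t ht => hS' s (hSS' hs) t (hSS' ht)
  let M : QMatCat F .linearStrong := ⟨E, QMatroid.uniformOne F E⟩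
  let N : QMatCat F .linearStrong := ⟨E × E, QMatroid.spreadMatroid S hS⟩
  let N' : QMatCat F .linearStrong := ⟨E × E, QMatroid.spreadMatroid S' hS'⟩
  have hN : ∀ f : E →ₗ[F] E × E, Function.Injective f → f.range ∈ S →
      (LClass.mk (LMap.ofLinear f)).IsOfType .linearStrong M.matroid N.matroid :=
    fun f hf hfS => ⟨⟨_, rfl, LMap.isLinear_ofLinear f⟩,
      ⟨_, rfl, QMatroid.isStrong_uniformOne_spreadMatroid (hS := hS) hf hfS⟩⟩
  have hN' : ∀ f : E →ₗ[F] E × E, Function.Injective f → f.range ∈ S' →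
      (LClass.mk (LMap.ofLinear f)).IsOfType .linearStrong M.matroid N'.matroid :=
    fun f hf hfS => ⟨⟨_, rfl, LMap.isLinear_ofLinear f⟩,
      ⟨_, rfl, QMatroid.isStrong_uniformOne_spreadMatroid (hS := hS') hf hfS⟩⟩
  let f₁ : M ⟶ N := Hom.mk (N := N) _ (hN ι₁ LinearMap.inl_injective (.inl rfl))
  let f₂ : M ⟶ N := Hom.mk (N := N) _ (hN ι₂ LinearMap.inr_injective (.inr rfl))
  let g₁ : M ⟶ N' := Hom.mk (N := N') _ (hN' ι₁ LinearMap.inl_injective (.inl rfl))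
  let g₂ : M ⟶ N' := Hom.mk (N := N') _ (hN' ι₂ LinearMap.inr_injective (.inr (.inl rfl)))
  obtain ⟨α, hα, hα'⟩ := exists_linear_rep hF (coprod.inl : M ⟶ M ⨿ M)
  obtain ⟨β, hβ, hβ'⟩ := exists_linear_rep hF (coprod.inr : M ⟶ M ⨿ M)
  obtain ⟨u, hu, hu'⟩ := exists_linear_rep hF (coprod.desc f₁ f₂)
  obtain ⟨v, hv, hv'⟩ := exists_linear_rep hF (coprod.desc g₁ g₂)
  have uα : ∀ x : E, u (α x) = (x, (0 : E)) :=
    toFun_of_comp_eq hF (coprod.inl_desc f₁ f₂) hα hu (χ := LMap.ofLinear ι₁) rfl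
  have uβ : ∀ x : E, u (β x) = ((0 : E), x) :=
    toFun_of_comp_eq hF (coprod.inr_desc f₁ f₂) hβ hu (χ := LMap.ofLinear ι₂) rfl
  have vα : ∀ x : E, v (α x) = (x, (0 : E)) :=
    toFun_of_comp_eq hF (coprod.inl_desc g₁ g₂) hα hv (χ := LMap.ofLinear ι₁) rfl
  have vβ : ∀ x : E, v (β x) = ((0 : E), x) :=
    toFun_of_comp_eq hF (coprod.inr_desc g₁ g₂) hβ hv (χ := LMap.ofLinear ι₂) rfl
  let e₁ : E := (1, 0)
  let e₂ : E := (0, 1)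
  have he₁ : e₁ ≠ 0 := fun h => one_ne_zero (α := F) (congrArg Prod.fst h)
  let x : (M ⨿ M).carrier := α e₁ + β e₁
  let w : (M ⨿ M).carrier := α e₂ + β e₂
  let t : (M ⨿ M).carrier := α e₁
  let r := (M ⨿ M).matroid
  -- the preimage of the flat spanned by `(e₁, e₁)`
  have hux : u x = (e₁, e₁) := by
    change u (α e₁ + β e₁) = _
    rw [map_add, uα, uβ]
    exact Prod.ext (add_zero e₁) (zero_add e₁)
  have huw : u w = (e₂, e₂) := by
    change u (α e₂ + β e₂) = _
    rw [map_add, uα, uβ]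
    exact Prod.ext (add_zero e₂) (zero_add e₂)
  have hvx : v x = (e₁, e₁) := by
    change v (α e₁ + β e₁) = _
    rw [map_add, vα, vβ]
    exact Prod.ext (add_zero e₁) (zero_add e₁)
  have hvw : v w = (e₂, e₂) := by
    change v (α e₂ + β e₂) = _
    rw [map_add, vα, vβ]
    exact Prod.ext (add_zero e₂) (zero_add e₂)
  obtain ⟨X, hX, hXu⟩ := hu' (F ∙ ((e₁, e₁) : E × E)) (by
    refine QMatroid.isFlat_spreadMatroid_span (hS := hS) (fun h => he₁ (congrArg Prod.fst h)) ?_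
    rintro s (rfl | rfl) ⟨y, hy⟩
    · exact he₁ (congrArg Prod.snd hy).symm
    · exact he₁ (congrArg Prod.fst hy).symm)
  obtain ⟨Z, hZ, hZv⟩ := hv' δ.range (by
    refine QMatroid.isFlat_spreadMatroid_of_mem (hS := hS') (.inr (.inr rfl)) fun h => he₁ ?_
    have : δ e₁ ∈ δ.range := ⟨e₁, rfl⟩
    rw [h] at this
    exact congrArg Prod.fst ((Submodule.mem_bot F).1 this))
  have hX' : ∀ y, y ∈ X ↔ u y ∈ F ∙ ((e₁, e₁) : E × E) := fun y => Set.ext_iff.1 hXu y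
  have hZ' : ∀ y, y ∈ Z ↔ v y ∈ δ.range := fun y => Set.ext_iff.1 hZv y
  have hxX : x ∈ X := (hX' x).2 (hux ▸ Submodule.mem_span_singleton_self _)
  have hwX : w ∉ X := by
    rw [hX', huw]
    intro h
    obtain h | h := (mem_span_singleton_of_card_eq_two hF).1 h
    · exact one_ne_zero (α := F) (congrArg (fun y : E × E => y.1.2) h)
    · exact one_ne_zero (α := F) (congrArg (fun y : E × E => y.1.2) h)
  have hxZ : x ∈ Z := (hZ' x).2 (hvx ▸ ⟨e₁, rfl⟩)
  have hwZ : w ∈ Z := (hZ' w).2 (hvw ▸ ⟨e₂, rfl⟩)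
  have htZ : t ∉ Z := by
    rw [hZ']
    rintro ⟨y, hy⟩
    have hy' : (y, y) = (e₁, (0 : E)) := hy.trans (vα e₁)
    exact he₁ ((congrArg Prod.fst hy').symm.trans (congrArg Prod.snd hy'))
  have hle : ∀ {y : (M ⨿ M).carrier} {V : Submodule F (M ⨿ M).carrier}, y ∈ V → F ∙ y ≤ V :=
    fun h => (Submodule.span_singleton_le_iff_mem _ _).2 h
  have r₁ : r.rank (F ∙ x) < r.rank (F ∙ x ⊔ F ∙ w) := hX.rank_lt (hle hxX) hwX
  have r₂ : r.rank (F ∙ x ⊔ F ∙ w) < r.rank (F ∙ x ⊔ F ∙ w ⊔ F ∙ t) :=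
    hZ.rank_lt (sup_le (hle hxZ) (hle hwZ)) htZ
  have r₃ : r.rank (F ∙ x ⊔ F ∙ t) ≤ r.rank (F ∙ x) + 1 := r.rank_sup_span_singleton_le _ t
  -- a flat containing `x` and `t` contains the images of both summands
  obtain ⟨Y, hY, hYf, hYr⟩ := r.exists_isFlat_ge (F ∙ x ⊔ F ∙ t)
  have htY : t ∈ Y := hY (le_sup_right (a := F ∙ x) (Submodule.mem_span_singleton_self t))
  have hxY : x ∈ Y := hY (le_sup_left (b := F ∙ t) (Submodule.mem_span_singleton_self x))
  -- The preimage of `Y` under a strong map is a flat of the uniform `q`-matroid; it contains `e₁ ≠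
  -- 0`, so it is all of `E`.
  have full : ∀ γ : E →ₗ[F] (M ⨿ M).carrier, (LMap.ofLinear γ).IsStrong M.matroid r →
      γ e₁ ∈ Y → ∀ y, γ y ∈ Y := by
    intro γ hγ he y
    obtain ⟨V, hV, hVγ⟩ := hγ Y hYf
    have hV' : ∀ y, y ∈ V ↔ γ y ∈ Y := fun y => Set.ext_iff.1 hVγ y
    obtain rfl | rfl := QMatroid.isFlat_uniformOne_iff.1 hV
    · exact absurd ((Submodule.mem_bot F).1 ((hV' e₁).2 he)) he₁
    · exact (hV' y).1 trivial
  have hβY : β e₁ ∈ Y := by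
    have := Y.sub_mem hxY htY
    rwa [show x - t = β e₁ from add_sub_cancel_left _ _] at this
  have hwY : w ∈ Y := Y.add_mem (full α hα' htY e₂) (full β hβ' hβY e₂)
  have r₄ : r.rank (F ∙ x ⊔ F ∙ w ⊔ F ∙ t) ≤ r.rank Y :=
    r.rank_mono _ _ (sup_le (sup_le (hle hxY) (hle hwY)) (hle htY))
  omega

/-! ### Linear weak morphisms over the field with two elements -/

end QMatCat

namespace QMatroid

variable {F : Type u} [Field F] {E₁ E₂ E : Type u} [AddCommGroup E₁] [Module F E₁]
  [AddCommGroup E₂] [Module F E₂] [AddCommGroup E] [Module F E]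

theorem rank_sup_le (M : QMatroid F E) (V W : Submodule F E) :
    M.rank (V ⊔ W) ≤ M.rank V + M.rank W :=
  (Nat.le_add_right _ _).trans (M.rank_submodular V W)

/-- The linear map out of the direct sum given by two linear weak maps is weak. -/
theorem isWeak_coprod [FiniteDimensional F E₁] [FiniteDimensional F E₂] {M₁ : QMatroid F E₁}
    {M₂ : QMatroid F E₂} {M : QMatroid F E} {f₁ : E₁ →ₗ[F] E} {f₂ : E₂ →ₗ[F] E}
    (h₁ : (LMap.ofLinear f₁).IsWeak M₁ M) (h₂ : (LMap.ofLinear f₂).IsWeak M₂ M) :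
    (LMap.ofLinear (f₁.coprod f₂)).IsWeak (directSum M₁ M₂) M := by
  intro V
  obtain ⟨X, hX, hr⟩ := exists_directSumRank_eq M₁ M₂ V
  change M.rank (V.map (f₁.coprod f₂)) ≤ directSumRank M₁ M₂ V
  rw [hr]
  -- The minimizing `X` is controlled by the weakness of `f₁` and `f₂` on its projections. A
  -- complement of `X` in `V` contributes at most its dimension, which is the term `dim V - dim X`.
  obtain ⟨C, hC⟩ := Submodule.exists_isCompl (X.submoduleOf V)
  have hsup : X ⊔ C.map V.subtype = V := by
    have := congrArg (Submodule.map V.subtype) hC.sup_eq_top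
    rwa [Submodule.map_sup, Submodule.map_subtype_top, Submodule.submoduleOf,
      Submodule.map_comap_subtype, inf_eq_right.2 hX] at this
  have hdim : Module.finrank F X + Module.finrank F C = Module.finrank F V := by
    rw [← Submodule.finrank_add_eq_of_isCompl hC,
      (Submodule.submoduleOfEquivOfLe hX).finrank_eq]
  have hXle : X.map (f₁.coprod f₂) ≤
      (X.map (LinearMap.fst F E₁ E₂)).map f₁ ⊔ (X.map (LinearMap.snd F E₁ E₂)).map f₂ := by
    rintro _ ⟨x, hx, rfl⟩
    exact Submodule.add_mem_sup ⟨_, ⟨x, hx, rfl⟩, rfl⟩ ⟨_, ⟨x, hx, rfl⟩, rfl⟩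
  have a₁ := M.rank_mono _ _ hXle
  have a₂ := M.rank_sup_le ((X.map (LinearMap.fst F E₁ E₂)).map f₁)
    ((X.map (LinearMap.snd F E₁ E₂)).map f₂)
  have a₃ : M.rank ((X.map (LinearMap.fst F E₁ E₂)).map f₁) ≤ _ := h₁ _
  have a₄ : M.rank ((X.map (LinearMap.snd F E₁ E₂)).map f₂) ≤ _ := h₂ _
  have a₅ := M.rank_sup_le (X.map (f₁.coprod f₂)) ((C.map V.subtype).map (f₁.coprod f₂))
  rw [← Submodule.map_sup, hsup] at a₅
  have a₆ := M.rank_le_finrank ((C.map V.subtype).map (f₁.coprod f₂))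
  have a₇ := Submodule.finrank_map_le (f₁.coprod f₂) (C.map V.subtype)
  have a₈ := Submodule.finrank_map_le V.subtype C
  rw [projRank]
  omega

end QMatroid

namespace QMatCat

variable {F : Type u} [Field F]

theorem exists_linear_weak_rep {M N : QMatCat F .linearWeak} (hF : Nat.card F = 2) (f : M ⟶ N) :
    ∃ g : M.carrier →ₗ[F] N.carrier, LClass.mk (LMap.ofLinear g) = f.cls ∧
      (LMap.ofLinear g).IsWeak M.matroid N.matroid := by
  obtain ⟨⟨φ, hφ, hl⟩, ψ, hψ, hs⟩ := f.isOfType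
  obtain rfl : φ = ψ := LClass.mk_injective hF (hφ.trans hψ.symm)
  obtain ⟨g, rfl⟩ := LMap.exists_ofLinear_eq hl
  exact ⟨g, hφ, hs⟩

theorem exists_desc (hF : Nat.card F = 2) {M₁ M₂ N : QMatCat F .linearWeak} (f₁ : M₁ ⟶ N)
    (f₂ : M₂ ⟶ N) : ∃ f : directSum M₁ M₂ ⟶ N, inl M₁ M₂ ≫ f = f₁ ∧ inr M₁ M₂ ≫ f = f₂ := by
  obtain ⟨g₁, h₁, w₁⟩ := exists_linear_weak_rep hF f₁
  obtain ⟨g₂, h₂, w₂⟩ := exists_linear_weak_rep hF f₂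
  refine ⟨Hom.mk (M := directSum M₁ M₂) (LClass.mk (LMap.ofLinear (g₁.coprod g₂)))
    ⟨⟨_, rfl, LMap.isLinear_ofLinear _⟩, ⟨_, rfl, QMatroid.isWeak_coprod w₁ w₂⟩⟩,
    Hom.ext ?_, Hom.ext ?_⟩
  · exact (congrArg (fun g => LClass.mk (LMap.ofLinear g)) (LinearMap.coprod_inl g₁ g₂)).trans h₁
  · exact (congrArg (fun g => LClass.mk (LMap.ofLinear g)) (LinearMap.coprod_inr g₁ g₂)).trans h₂

/-- Equal classes on the summands are equal linear maps there, so the maps agree on the product. For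
larger fields the restrictions could differ by independent scalars, as with `diag(1, c)`. -/
theorem directSum_hom_ext (hF : Nat.card F = 2) {M₁ M₂ N : QMatCat F .linearWeak}
    {f g : directSum M₁ M₂ ⟶ N} (h₁ : inl M₁ M₂ ≫ f = inl M₁ M₂ ≫ g)
    (h₂ : inr M₁ M₂ ≫ f = inr M₁ M₂ ≫ g) : f = g := by
  obtain ⟨f', hf, -⟩ := exists_linear_weak_rep hF f
  obtain ⟨g', hg, -⟩ := exists_linear_weak_rep hF g
  have : f' = g' := by
    refine LinearMap.prod_ext (LinearMap.ext fun x => ?_) (LinearMap.ext fun x => ?_)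
    · exact toFun_of_comp_eq hF h₁ (φ := LMap.ofLinear (LinearMap.inl F _ _)) rfl hf
        (χ := LMap.ofLinear (g' ∘ₗ LinearMap.inl F M₁.carrier M₂.carrier))
        (by rw [comp_cls, ← hg]; rfl) x
    · exact toFun_of_comp_eq hF h₂ (φ := LMap.ofLinear (LinearMap.inr F _ _)) rfl hf
        (χ := LMap.ofLinear (g' ∘ₗ LinearMap.inr F M₁.carrier M₂.carrier))
        (by rw [comp_cls, ← hg]; rfl) x
  refine Hom.ext ?_
  rw [← hf, ← hg, this]

/-- Over the field with two elements, the direct sum is a coproduct in `q-Mat^[l-w]`. -/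
theorem nonempty_isColimit_directSum (hF : Nat.card F = 2) (M₁ M₂ : QMatCat F .linearWeak) :
    Nonempty (IsColimit (BinaryCofan.mk (inl M₁ M₂) (inr M₁ M₂))) := by
  choose d hd₁ hd₂ using fun (N : QMatCat F .linearWeak) (f₁ : M₁ ⟶ N) (f₂ : M₂ ⟶ N) =>
    exists_desc hF f₁ f₂
  exact ⟨BinaryCofan.isColimitMk (fun s => d _ s.inl s.inr) (fun s => hd₁ _ _ _)
    (fun s => hd₂ _ _ _) fun s m h₁ h₂ => directSum_hom_ext hF (h₁.trans (hd₁ _ _ _).symm)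
      (h₂.trans (hd₂ _ _ _).symm)⟩

end QMatCat

/-- Over a finite field with `q` elements, the category of `q`-matroids with `𝓛`-classes of type
`Δ` as morphisms has (binary) coproducts exactly if `q = 2` and `Δ` is linear-weak; in that case
the direct sum with the classes of the natural embeddings is the coproduct. -/
theorem mainTheorem5 (F : Type u) [Field F] [Finite F] :
    (∀ Δ : MapType,
      HasBinaryCoproducts (QMatCat F Δ) ↔ (Nat.card F = 2 ∧ Δ = MapType.linearWeak)) ∧
    (Nat.card F = 2 → ∀ M₁ M₂ : QMatCat F MapType.linearWeak,
      Nonempty (IsColimit (BinaryCofan.mk (QMatCat.inl M₁ M₂) (QMatCat.inr M₁ M₂)))) := by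
  refine ⟨fun Δ => ⟨fun h => ?_, ?_⟩, QMatCat.nonempty_isColimit_directSum⟩
  · have hF : Nat.card F = 2 := by
      by_contra hF
      exact QMatCat.not_hasBinaryCoproducts_of_card_ne_two hF Δ h
    refine ⟨hF, ?_⟩
    cases Δ with
    -- For the nonlinear types `MapType.Linear` reduces to `False`, so the identity proves its
    -- negation.
    | strong => exact absurd h (QMatCat.not_hasBinaryCoproducts_of_not_linear hF _root_.id)
    | rankPreserving => exact absurd h (QMatCat.not_hasBinaryCoproducts_of_not_linear hF _root_.id)
    | weak => exact absurd h (QMatCat.not_hasBinaryCoproducts_of_not_linear hF _root_.id)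
    | linearStrong => exact absurd h (QMatCat.not_hasBinaryCoproducts_linearStrong hF)
    | linearRankPreserving => exact absurd h QMatCat.not_hasBinaryCoproducts_linearRankPreserving
    | linearWeak => rfl
  · rintro ⟨hF, rfl⟩
    have : ∀ M₁ M₂ : QMatCat F .linearWeak, HasColimit (pair M₁ M₂) := fun M₁ M₂ =>
      ⟨⟨⟨_, (QMatCat.nonempty_isColimit_directSum hF M₁ M₂).some⟩⟩⟩
    exact hasBinaryCoproducts_of_hasColimit_pair _
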